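/- Let $h>0$ and let $g:\mathbb{R}_+\to\mathbb{R}_+$ (where $\mathbb{R}_+=[0,\infty)$) be Lipschitz continuous with constant $L_g$ and have exactly two fixed points, $0$ and $\kappa>0$ (so that $L_g\ge 1$). A semi-wavefront with speed $c>0$ of $$u_t(t,x)=u_{xx}(t,x)-u(t,x)+g(u(t-h,x)),\qquad t>0,\ x\in\mathbb{R},$$ is a function $\phi:\mathbb{R}\to\mathbb{R}$ with $\phi(-\infty)=0$ such that $u(t,x)=\phi(x+ct)$ is a bounded positive classical solution of this equation. For $c>0$ and $\lambda\in\mathbb{R}$ put $E_c(\lambda)=-\lambda^2+c\lambda+1-L_g e^{-\lambda ch}$ and $$c(L_g)=\inf\{c>0:\ E_c(\lambda_0)\ge 0\ \text{for some}\ \lambda_0\in\mathbb{R}\}.$$ For $c>0$ with $c\ge c(L_g)$ let $\lambda_1(c)\le\lambda_2(c)$ be the two real zeros of $E_c$, counted with multiplicity, fix any $\lambda_c\in[\lambda_1(c),\lambda_2(c)]$, and let $\xi_c(z)=e^{-\lambda_c z}$. **Corollary (Uniqueness).** If $\phi_1$ and $\phi_2$ are two semi-wavefronts with the same speed $c\ge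 c(L_g)$ such that $\xi_c\,|\phi_1-\phi_2|\in L^1(\mathbb{R})$, then $\phi_1=\phi_2$. -/

import Mathlib

open Set Filter Topology MeasureTheory
open scoped NNReal

namespace DelayedRD

/-- `u t x` is a classical solution, for `t > 0` and `x ∈ ℝ`, of the delayed reaction-diffusion
equation `u_t(t,x) = u_xx(t,x) - u(t,x) + g(u(t-h,x))`. -/
structure IsSolution (g : ℝ → ℝ) (h : ℝ) (u : ℝ → ℝ → ℝ) : Prop where
  differentiableAt_time : ∀ t > 0, ∀ x, DifferentiableAt ℝ (fun s => u s x) t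
  differentiable_space : ∀ t > 0, Differentiable ℝ (u t)
  differentiable_deriv_space : ∀ t > 0, Differentiable ℝ (deriv (u t))
  equation : ∀ t > 0, ∀ x,
    deriv (fun s => u s x) t = deriv (deriv (u t)) x - u t x + g (u (t - h) x)

/-- `φ` is (the profile of) a semi-wavefront with speed `c`: `c > 0`, the function
`u(t,x) = φ(x + ct)` is a bounded positive solution, and `φ(-∞) = 0`. -/
structure IsSemiWavefront (g : ℝ → ℝ) (h c : ℝ) (φ : ℝ → ℝ) : Prop where
  speed_pos : 0 < c
  isSolution : IsSolution g h (fun t x => φ (x + c * t))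
  pos : ∀ z, 0 < φ z
  bounded : ∃ M, ∀ z, φ z ≤ M
  tendsto_atBot : Tendsto φ atBot (𝓝 0)

/-- The characteristic function `E_c(μ) = -μ² + cμ + 1 - L e^{-μch}`. -/
noncomputable def charFun (L h c μ : ℝ) : ℝ :=
  -μ ^ 2 + c * μ + 1 - L * Real.exp (-(μ * c * h))

/-- The speed `c(L) = inf {c > 0 : E_c(μ₀) ≥ 0 for some real μ₀}`. -/
noncomputable def critSpeed (L h : ℝ) : ℝ :=
  sInf {c : ℝ | 0 < c ∧ ∃ μ₀ : ℝ, 0 ≤ charFun L h c μ₀}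

/-- The smaller real zero `λ₁(c)` of `E_c`. -/
noncomputable def lam₁ (L h c : ℝ) : ℝ := sInf {μ : ℝ | charFun L h c μ = 0}

/-- The larger real zero `λ₂(c)` of `E_c` (equal to `λ₁(c)` if the zero is double). -/
noncomputable def lam₂ (L h c : ℝ) : ℝ := sSup {μ : ℝ | charFun L h c μ = 0}

/-- The weight `ξ(z) = e^{-μz}`. -/
noncomputable def weight (μ z : ℝ) : ℝ := Real.exp (-(μ * z))

end DelayedRD

/-!
Let `w = φ₁ - φ₂` and `y = e^{-μz} w` with `μ = lam_c`. Since each profile satisfies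
`φ'' - cφ' - φ + g(φ(· - ch)) = 0`, and `g` is Lipschitz with constant `L`,
`y'' + (2μ - c) y' - p y + f = 0`, where `|f(z)| ≤ q |y(z - ch)|`, `p = 1 + cμ - μ²` and
`q = L e^{-μch}`. The condition `E_c(μ) ≥ 0` says exactly that `q ≤ p`.

* **Maximum principle** (`eq_zero_of_integrable_delay`). At a point `z₀` where `|y|` attains its
  maximum `M`, the equation gives `p M ≤ q |y(z₀ - ch)|`, so `|y(z₀ - ch)| = M` as well. By
  iteration `|y(z₀ - n ch)| = M` for every `n`, which contradicts `y → 0` at `-∞` unless `M = 0`.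
  The critical case `p = q` needs no separate treatment.
* **Decay** (`tendsto_zero_of_integrable_of_bounded`). That `y → 0` at `±∞`, which is also why the
  maximum is attained, follows from `y ∈ L¹`: the derivative of `y' + (2μ - c) y` is integrable, so
  this function is bounded, and then `√(1 + y²) - 1` is integrable with an integrable derivative.
* **Characteristic function** (`charFun_nonneg_of_mem_Icc`). That `E_c ≥ 0` on `[λ₁(c), λ₂(c)]`
  holds by concavity, once `E_c` is known to have zeros. This uses `L > 1`, which follows from `0`
  and `κ` being the only fixed points, and the fact that the infimum defining the critical speed is
  attained whenever it is positive, by compactness.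
-/

namespace DelayedRD

/-! ### Decay of integrable functions -/

theorem abs_le_of_integrable_deriv {G G' : ℝ → ℝ} (hG : ∀ z, HasDerivAt G (G' z) z)
    (hint : Integrable G') (z : ℝ) : |G z| ≤ |G 0| + ∫ s, |G' s| := by
  have h1 : ∫ s in (0 : ℝ)..z, G' s = G z - G 0 :=
    intervalIntegral.integral_eq_sub_of_hasDerivAt (fun s _ => hG s) hint.intervalIntegrable
  have h2 : |∫ s in (0 : ℝ)..z, G' s| ≤ ∫ s, |G' s| := by
    have h3 := intervalIntegral.norm_integral_le_integral_norm_uIoc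
      (f := G') (a := 0) (b := z) (μ := volume)
    exact h3.trans (setIntegral_le_integral hint.abs (ae_of_all _ fun s => abs_nonneg _))
  have h4 : |G z| ≤ |G 0| + |G z - G 0| := by
    simpa using abs_add_le (G 0) (G z - G 0)
  rw [h1] at h2
  linarith

/-- An integrable function `y` for which `y' + a y` is bounded vanishes at infinity. The bound on
`y' + a y` does not make `y'` integrable, but it does make the derivative `y y' / √(1 + y²)` of
`√(1 + y²) - 1` integrable, because `|y| / √(1 + y²)` is at most both `|y|` and `1`. -/
theorem tendsto_zero_of_integrable_of_bounded {y y' : ℝ → ℝ} {a B : ℝ}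
    (hy : ∀ z, HasDerivAt y (y' z) z) (hint : Integrable y)
    (hB : ∀ z, |y' z + a * y z| ≤ B) : Tendsto y (cocompact ℝ) (𝓝 0) := by
  have hcont : Continuous y := continuous_iff_continuousAt.2 fun z => (hy z).continuousAt
  have hpos : ∀ z, 0 < 1 + y z ^ 2 := fun z => by positivity
  have hone : ∀ z, 1 ≤ √(1 + y z ^ 2) := fun z =>
    Real.one_le_sqrt.2 (by nlinarith [sq_nonneg (y z)])
  have habs : ∀ z, |y z| ≤ √(1 + y z ^ 2) := fun z => Real.abs_le_sqrt (by linarith)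
  have hsq : ∀ z, √(1 + y z ^ 2) ^ 2 = 1 + y z ^ 2 := fun z => Real.sq_sqrt (hpos z).le
  set F : ℝ → ℝ := fun z => √(1 + y z ^ 2) - 1 with hF
  set F' : ℝ → ℝ := fun z => y z * y' z / √(1 + y z ^ 2) with hF'
  have hFd : ∀ z, HasDerivAt F (F' z) z := by
    intro z
    have h1 := ((((hy z).fun_pow 2).const_add 1).sqrt (hpos z).ne').sub_const 1
    refine h1.congr_deriv ?_
    simp only [hF']
    rw [← mul_div_mul_left (y z * y' z) _ two_ne_zero]
    push_cast
    ring
  have hFint : Integrable F := by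
    refine hint.abs.mono' (by fun_prop) (ae_of_all _ fun z => ?_)
    rw [Real.norm_eq_abs, abs_of_nonneg (by simp only [hF]; linarith [hone z])]
    have : √(1 + y z ^ 2) ≤ 1 + |y z| :=
      Real.sqrt_le_iff.2 ⟨by positivity, by nlinarith [sq_abs (y z), abs_nonneg (y z)]⟩
    linarith
  have hy'meas : Measurable y' := by
    have : y' = deriv y := funext fun z => (hy z).deriv.symm
    rw [this]
    exact measurable_deriv y
  have hF'int : Integrable F' := by
    refine (hint.abs.const_mul (B + |a|)).mono'
      ((hcont.measurable.mul hy'meas).div (by fun_prop)).aestronglyMeasurable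
      (ae_of_all _ fun z => ?_)
    have hs : 0 < √(1 + y z ^ 2) := one_pos.trans_le (hone z)
    have h1 : |y' z| ≤ B + |a| * |y z| := by
      have := abs_sub (y' z + a * y z) (a * y z)
      rw [add_sub_cancel_right, abs_mul] at this
      linarith [hB z]
    have hB0 : 0 ≤ B := (abs_nonneg _).trans (hB z)
    simp only [hF', Real.norm_eq_abs, abs_div, abs_mul, abs_of_pos hs]
    rw [div_le_iff₀ hs]
    have h2 : |y z| * B ≤ |y z| * B * √(1 + y z ^ 2) :=
      le_mul_of_one_le_right (by positivity) (hone z)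
    have h3 : |y z| * |a| * |y z| ≤ |y z| * |a| * √(1 + y z ^ 2) :=
      mul_le_mul_of_nonneg_left (habs z) (by positivity)
    have h4 := mul_le_mul_of_nonneg_left h1 (abs_nonneg (y z))
    linarith
  have hF0 : Tendsto F (cocompact ℝ) (𝓝 0) := by
    rw [cocompact_eq_atBot_atTop]
    exact (tendsto_zero_of_hasDerivAt_of_integrableOn_Iic (a := 0) (fun z _ => hFd z)
      hF'int.integrableOn hFint.integrableOn).sup
      (tendsto_zero_of_hasDerivAt_of_integrableOn_Ioi (a := 0) (fun z _ => hFd z)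
      hF'int.integrableOn hFint.integrableOn)
  have h2 : Tendsto (fun z => √(F z * (F z + 2))) (cocompact ℝ) (𝓝 0) := by
    have := (hF0.mul (hF0.add_const 2)).sqrt
    simpa using this
  refine (tendsto_zero_iff_abs_tendsto_zero _).2 (h2.congr fun z => ?_)
  have : F z * (F z + 2) = y z ^ 2 := by
    simp only [hF]
    linear_combination hsq z
  rw [this, Real.sqrt_sq_eq_abs]
  rfl

/-! ### The maximum principle with delay -/

theorem second_deriv_nonpos_of_isMax {y y' : ℝ → ℝ} {y'' z₀ : ℝ}
    (hy : ∀ z, HasDerivAt y (y' z) z) (hy' : HasDerivAt y' y'' z₀)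
    (hmax : ∀ z, y z ≤ y z₀) : y'' ≤ 0 := by
  by_contra! hpos
  have hd : deriv y = y' := funext fun z => (hy z).deriv
  have hloc : IsLocalMax y z₀ := Eventually.of_forall hmax
  have hmin : IsLocalMin y z₀ := isLocalMin_of_deriv_deriv_pos
    (by rw [hd, hy'.deriv]; exact hpos) hloc.deriv_eq_zero (hy z₀).continuousAt
  -- if `y'' > 0`, the maximum is a local minimum as well, so `y` is locally constant
  have hconst : y =ᶠ[𝓝 z₀] fun _ => y z₀ :=
    hmin.mono fun z hz => le_antisymm (hmax z) hz
  have h2 : y' =ᶠ[𝓝 z₀] fun _ => 0 := by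
    have := hconst.deriv
    rw [hd] at this
    simpa using this
  have h3 := h2.deriv_eq
  rw [hy'.deriv] at h3
  simp at h3
  exact hpos.ne' h3

theorem le_delay_of_isMax {y y' y'' f : ℝ → ℝ} {a p q τ z₀ : ℝ}
    (hy : ∀ z, HasDerivAt y (y' z) z) (hy' : ∀ z, HasDerivAt y' (y'' z) z)
    (heq : ∀ z, y'' z + a * y' z - p * y z + f z = 0)
    (hf : ∀ z, |f z| ≤ q * |y (z - τ)|) (hmax : ∀ z, |y z| ≤ |y z₀|) :
    p * |y z₀| ≤ q * |y (z₀ - τ)| := by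
  rcases le_total 0 (y z₀) with h0 | h0
  · rw [abs_of_nonneg h0] at hmax ⊢
    have hm : ∀ z, y z ≤ y z₀ := fun z => (le_abs_self _).trans (hmax z)
    have h1 := second_deriv_nonpos_of_isMax hy (hy' z₀) hm
    have h2 : y' z₀ = 0 :=
      IsLocalMax.hasDerivAt_eq_zero (Eventually.of_forall hm) (hy z₀)
    have h3 := heq z₀
    rw [h2] at h3
    linarith [hf z₀, le_abs_self (f z₀)]
  · rw [abs_of_nonpos h0] at hmax ⊢
    have hm : ∀ z, -y z ≤ -y z₀ := fun z => (neg_le_abs _).trans (hmax z)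
    have h1 := second_deriv_nonpos_of_isMax (fun z => (hy z).fun_neg) (hy' z₀).fun_neg hm
    have h2 : -y' z₀ = 0 :=
      IsLocalMax.hasDerivAt_eq_zero (Eventually.of_forall hm) (hy z₀).fun_neg
    have h3 := heq z₀
    rw [neg_eq_zero.1 h2] at h3
    linarith [hf z₀, neg_le_abs (f z₀)]

/-- Uniqueness of the zero solution among integrable solutions of a delayed linear differential
inequality, under the non-strict condition `q ≤ p`. -/
theorem eq_zero_of_integrable_delay {y y' y'' f : ℝ → ℝ} {a p q τ : ℝ}
    (hy : ∀ z, HasDerivAt y (y' z) z) (hy' : ∀ z, HasDerivAt y' (y'' z) z)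
    (heq : ∀ z, y'' z + a * y' z - p * y z + f z = 0)
    (hf : ∀ z, |f z| ≤ q * |y (z - τ)|) (hτ : 0 < τ) (hq : 0 < q) (hqp : q ≤ p)
    (hint : Integrable y) (z : ℝ) : y z = 0 := by
  have hcont : Continuous y := continuous_iff_continuousAt.2 fun z => (hy z).continuousAt
  have hcont' : Continuous y' := continuous_iff_continuousAt.2 fun z => (hy' z).continuousAt
  have hy''meas : Measurable y'' := by
    have : y'' = deriv y' := funext fun z => (hy' z).deriv.symm
    rw [this]
    exact measurable_deriv y'
  have hfint : Integrable f := by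
    have hfm : Measurable f := by
      have : f = fun z => p * y z - a * y' z - y'' z := funext fun z => by linarith [heq z]
      rw [this]
      exact ((hcont.measurable.const_mul p).sub (hcont'.measurable.const_mul a)).sub hy''meas
    exact ((hint.comp_sub_right τ).abs.const_mul q).mono' hfm.aestronglyMeasurable
      (ae_of_all _ hf)
  have hGd : ∀ z, HasDerivAt (fun z => y' z + a * y z) (p * y z - f z) z := fun z => by
    refine ((hy' z).fun_add ((hy z).const_mul a)).congr_deriv ?_
    linarith [heq z]
  -- `y' + a y` has integrable derivative `p y - f`, so it is bounded
  have hlim : Tendsto y (cocompact ℝ) (𝓝 0) :=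
    tendsto_zero_of_integrable_of_bounded hy hint
      (abs_le_of_integrable_deriv hGd ((hint.const_mul p).sub hfint))
  by_contra hz
  have hzpos : 0 < |y z| := abs_pos.2 hz
  have hlim' : Tendsto (fun s => |y s|) (cocompact ℝ) (𝓝 0) := by simpa using hlim.abs
  obtain ⟨z₀, hz₀⟩ := hcont.abs.exists_forall_ge' z
    ((hlim'.eventually_lt_const hzpos).mono fun s hs => hs.le)
  have hM : 0 < |y z₀| := hzpos.trans_le (hz₀ z)
  -- the maximum of `|y|` propagates along the steps of the delay
  have hprop : ∀ n : ℕ, |y (z₀ - n * τ)| = |y z₀| := by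
    intro n
    induction n with
    | zero => simp
    | succ n ih =>
      have h1 := le_delay_of_isMax hy hy' heq hf (z₀ := z₀ - n * τ)
        (fun s => by rw [ih]; exact hz₀ s)
      rw [ih] at h1
      have h2 : z₀ - (n + 1 : ℕ) * τ = z₀ - n * τ - τ := by push_cast; ring
      rw [h2]
      refine le_antisymm (hz₀ _) (le_of_mul_le_mul_left ?_ hq)
      exact (mul_le_mul_of_nonneg_right hqp hM.le).trans h1
  have hseq : Tendsto (fun n : ℕ => z₀ - n * τ) atTop atBot :=
    tendsto_const_nhds.add_atBot (tendsto_neg_atTop_atBot.comp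
      (tendsto_natCast_atTop_atTop.atTop_mul_const hτ))
  have h3 : Tendsto (fun n : ℕ => |y (z₀ - n * τ)|) atTop (𝓝 0) :=
    hlim'.comp (hseq.mono_right atBot_le_cocompact)
  simp only [hprop] at h3
  exact hM.ne' (tendsto_nhds_unique tendsto_const_nhds h3)

/-! ### The characteristic function -/

/-- If the Lipschitz constant were at most `1`, the midpoint of the two fixed points `0` and `κ`
would be a third one. -/
theorem one_lt_of_fixedPoints {g : ℝ → ℝ} {L : ℝ≥0} {κ : ℝ} (hκ : 0 < κ)
    (hg_lip : LipschitzOnWith L g (Set.Ici 0))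
    (hg_fix : ∀ u : ℝ, 0 ≤ u → (g u = u ↔ u = 0 ∨ u = κ)) : 1 < (L : ℝ) := by
  by_contra! hL
  have h0 : g 0 = 0 := (hg_fix 0 le_rfl).2 (Or.inl rfl)
  have h1 : g κ = κ := (hg_fix κ hκ.le).2 (Or.inr rfl)
  have hm : (0 : ℝ) ≤ κ / 2 := by linarith
  have e0 := hg_lip.dist_le_mul (κ / 2) hm 0 (by simp)
  have e1 := hg_lip.dist_le_mul κ hκ.le (κ / 2) hm
  rw [Real.dist_eq, Real.dist_eq, h0, sub_zero, sub_zero, abs_of_nonneg hm] at e0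
  rw [Real.dist_eq, Real.dist_eq, h1, show κ - κ / 2 = κ / 2 by ring, abs_of_nonneg hm] at e1
  have e2 : (L : ℝ) * (κ / 2) ≤ κ / 2 := by nlinarith
  have h2 : g (κ / 2) = κ / 2 := by
    linarith [le_abs_self (g (κ / 2)), le_abs_self (κ - g (κ / 2))]
  rcases (hg_fix _ hm).1 h2 with h | h <;> linarith

theorem pos_of_charFun_nonneg {L h c μ : ℝ} (hL : 1 < L) (hh : 0 < h) (hc : 0 < c)
    (hμ : 0 ≤ charFun L h c μ) : 0 < μ := by
  by_contra! hle
  unfold charFun at hμ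
  have h1 : 1 ≤ Real.exp (-(μ * c * h)) := by
    apply Real.one_le_exp
    have : 0 ≤ (-μ) * c * h := by have := neg_nonneg.2 hle; positivity
    linarith
  nlinarith [mul_nonneg hc.le (neg_nonneg.2 hle), sq_nonneg μ]

theorem lt_of_charFun_nonneg {L h c μ : ℝ} (hL : 1 < L) (hh : 0 < h) (hc : 0 < c)
    (hμ : 0 ≤ charFun L h c μ) : μ < c + 1 := by
  have hpos := pos_of_charFun_nonneg hL hh hc hμ
  by_contra! hle
  unfold charFun at hμ
  have h1 : 0 < L * Real.exp (-(μ * c * h)) := by positivity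
  nlinarith [mul_nonneg hpos.le (sub_nonneg.2 hle)]

theorem charFun_mono_speed {L h c c' μ : ℝ} (hL : 0 ≤ L) (hh : 0 ≤ h) (hcc : c ≤ c')
    (hμ : 0 ≤ μ) : charFun L h c μ ≤ charFun L h c' μ := by
  have h1 : μ * c ≤ μ * c' := mul_le_mul_of_nonneg_left hcc hμ
  have h2 : μ * c * h ≤ μ * c' * h := mul_le_mul_of_nonneg_right h1 hh
  have h3 : Real.exp (-(μ * c' * h)) ≤ Real.exp (-(μ * c * h)) :=
    Real.exp_le_exp.2 (by linarith)
  have h4 := mul_le_mul_of_nonneg_left h3 hL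
  unfold charFun
  linarith

theorem concaveOn_charFun {L : ℝ} (h c : ℝ) (hL : 0 ≤ L) :
    ConcaveOn ℝ univ (charFun L h c) := by
  refine ⟨convex_univ, fun x _ y _ a b ha hb hab => ?_⟩
  have h1 := convexOn_exp.2 (mem_univ (-(x * c * h))) (mem_univ (-(y * c * h))) ha hb hab
  have h2 := (even_two.convexOn_pow (𝕜 := ℝ)).2 (mem_univ x) (mem_univ y) ha hb hab
  simp only [smul_eq_mul] at h1 h2 ⊢
  rw [show a * -(x * c * h) + b * -(y * c * h) = -((a * x + b * y) * c * h) by ring] at h1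
  have h3 := mul_le_mul_of_nonneg_left h1 hL
  unfold charFun
  linarith

theorem continuous_charFun (L h : ℝ) : Continuous fun x : ℝ × ℝ => charFun L h x.1 x.2 := by
  unfold charFun
  fun_prop

theorem exists_speed (L h : ℝ) (hL : 0 ≤ L) (hh : 0 ≤ h) :
    {c : ℝ | 0 < c ∧ ∃ μ₀ : ℝ, 0 ≤ charFun L h c μ₀}.Nonempty := by
  refine ⟨L + 1, by positivity, 1, ?_⟩
  have h1 : Real.exp (-(1 * (L + 1) * h)) ≤ 1 :=
    Real.exp_le_one_iff.2 (by have : 0 ≤ (L + 1) * h := by positivity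
                              linarith)
  unfold charFun
  nlinarith

/-- The set of admissible speeds is upward closed and contains its infimum when that is positive:
the points `μ` with `E_{c'}(μ) ≥ 0` stay in a compact set while `c'` decreases to `c`. -/
theorem exists_charFun_nonneg {L h c : ℝ} (hL : 1 < L) (hh : 0 < h) (hc0 : 0 < c)
    (hc : critSpeed L h ≤ c) : ∃ μ, 0 ≤ charFun L h c μ := by
  have hL0 : 0 ≤ L := by linarith
  by_contra! hneg
  set K : Set (ℝ × ℝ) := (Icc c (c + 1) ×ˢ Icc 0 (c + 2)) ∩ {x | 0 ≤ charFun L h x.1 x.2} with hK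
  have hKc : IsCompact K := (isCompact_Icc.prod isCompact_Icc).inter_right
    (isClosed_le continuous_const (continuous_charFun L h))
  have hcl : IsClosed (Prod.fst '' K) := (hKc.image continuous_fst).isClosed
  have hmem : c ∈ Prod.fst '' K := by
    rw [← hcl.closure_eq, Metric.mem_closure_iff]
    intro ε hε
    obtain ⟨c', ⟨hc'0, μ, hμ⟩, hlt⟩ := exists_lt_of_csInf_lt (exists_speed L h hL0 hh.le)
      (show sInf _ < c + min ε 1 from hc.trans_lt (by have := lt_min hε one_pos; linarith))
    have hμ0 := pos_of_charFun_nonneg hL hh hc'0 hμ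
    have hμ1 := lt_of_charFun_nonneg hL hh hc'0 hμ
    have hcc' : c < c' := by
      by_contra! hle
      exact (hneg μ).not_ge (hμ.trans (charFun_mono_speed hL0 hh.le hle hμ0.le))
    have hε' := min_le_left ε 1
    have hone := min_le_right ε 1
    refine ⟨c', ⟨(c', μ), ⟨⟨⟨hcc'.le, by linarith⟩, hμ0.le, by dsimp only; linarith⟩, hμ⟩, rfl⟩, ?_⟩
    rw [Real.dist_eq, abs_sub_comm, abs_of_pos (by linarith)]
    linarith
  obtain ⟨⟨_, μ⟩, ⟨-, hμ⟩, rfl⟩ := hmem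
  exact (hneg μ).not_ge hμ

theorem charFun_nonneg_of_mem_Icc {L h c μ : ℝ} (hL : 1 < L) (hh : 0 < h) (hc0 : 0 < c)
    (hc : critSpeed L h ≤ c) (hμ : μ ∈ Icc (lam₁ L h c) (lam₂ L h c)) :
    0 ≤ charFun L h c μ := by
  have hcont : Continuous (charFun L h c) := (continuous_charFun L h).comp (.prodMk_right c)
  set Z : Set ℝ := {μ | charFun L h c μ = 0} with hZ
  have hZcl : IsClosed Z := isClosed_eq hcont continuous_const
  have hbelow : BddBelow Z := ⟨0, fun μ hμ => (pos_of_charFun_nonneg hL hh hc0 (Eq.ge hμ)).le⟩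
  have habove : BddAbove Z := ⟨c + 1, fun μ hμ => (lt_of_charFun_nonneg hL hh hc0 (Eq.ge hμ)).le⟩
  have hne : Z.Nonempty := by
    obtain ⟨μ₀, hμ₀⟩ := exists_charFun_nonneg hL hh hc0 hc
    have h0 : charFun L h c 0 ≤ 0 := by simp [charFun]; linarith
    obtain ⟨ν, -, hν⟩ := intermediate_value_Icc (pos_of_charFun_nonneg hL hh hc0 hμ₀).le
      hcont.continuousOn ⟨h0, hμ₀⟩
    exact ⟨ν, hν⟩
  have h1 : charFun L h c (lam₁ L h c) = 0 := hZcl.csInf_mem hne hbelow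
  have h2 : charFun L h c (lam₂ L h c) = 0 := hZcl.csSup_mem hne habove
  have h3 := (concaveOn_charFun h c (by linarith : 0 ≤ L)).ge_on_segment (mem_univ (lam₁ L h c))
    (mem_univ (lam₂ L h c)) (by rwa [segment_eq_Icc (hμ.1.trans hμ.2)])
  rwa [h1, h2, min_self] at h3

/-! ### The profile equation and uniqueness -/

theorem IsSemiWavefront.profile_equation {g : ℝ → ℝ} {h c : ℝ} {φ : ℝ → ℝ}
    (hφ : IsSemiWavefront g h c φ) :
    Differentiable ℝ φ ∧ Differentiable ℝ (deriv φ) ∧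
      ∀ z, deriv (deriv φ) z - c * deriv φ z - φ z + g (φ (z - c * h)) = 0 := by
  have hd : ∀ t x, deriv (fun x => φ (x + c * t)) x = deriv φ (x + c * t) :=
    fun t x => deriv_comp_add_const φ (c * t) x
  have hd1 : deriv (fun x => φ (x + c * 1)) = fun x => deriv φ (x + c * 1) := funext (hd 1)
  have h1 : Differentiable ℝ φ := by
    have := (hφ.isSolution.differentiable_space 1 one_pos).comp
      (differentiable_id.sub_const (c * 1))
    simpa [Function.comp_def] using this
  have h2 : Differentiable ℝ (deriv φ) := by
    have := hφ.isSolution.differentiable_deriv_space 1 one_pos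
    rw [hd1] at this
    simpa [Function.comp_def] using this.comp (differentiable_id.sub_const (c * 1))
  refine ⟨h1, h2, fun z => ?_⟩
  -- the equation at time `1` already determines the profile equation at every `z`
  have h3 := hφ.isSolution.equation 1 one_pos (z - c * 1)
  have h4 : deriv (fun s => φ (z - c * 1 + c * s)) 1 = c * deriv φ z := by
    have hin : HasDerivAt (fun s : ℝ => z - c * 1 + c * s) c 1 := by
      simpa using ((hasDerivAt_id (1 : ℝ)).const_mul c).const_add (z - c * 1)
    have hz : HasDerivAt φ (deriv φ z) (z - c * 1 + c * 1) := by
      simpa using (h1 z).hasDerivAt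
    exact ((hz.comp (1 : ℝ) hin).congr_deriv (mul_comm _ _)).deriv
  have h5 : deriv (fun x => deriv φ (x + c * 1)) (z - c * 1) = deriv (deriv φ) z := by
    rw [deriv_comp_add_const, sub_add_cancel]
  rw [h4, hd1, h5, sub_add_cancel, show z - c * 1 + c * (1 - h) = z - c * h by ring] at h3
  linarith

end DelayedRD

theorem mainTheorem6
    (h : ℝ) (hh : 0 < h)
    (g : ℝ → ℝ) (Lg : ℝ≥0) (κ : ℝ) (hκ : 0 < κ)
    (hg_maps : Set.MapsTo g (Set.Ici 0) (Set.Ici 0))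
    (hg_lip : LipschitzOnWith Lg g (Set.Ici 0))
    (hg_fix : ∀ u : ℝ, 0 ≤ u → (g u = u ↔ u = 0 ∨ u = κ))
    (c : ℝ) (hc : DelayedRD.critSpeed Lg h ≤ c)
    (lam_c : ℝ) (hlam : lam_c ∈ Set.Icc (DelayedRD.lam₁ Lg h c) (DelayedRD.lam₂ Lg h c))
    (φ₁ φ₂ : ℝ → ℝ)
    (hφ₁ : DelayedRD.IsSemiWavefront g h c φ₁)
    (hφ₂ : DelayedRD.IsSemiWavefront g h c φ₂)
    (hic : MeasureTheory.Integrable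
      (fun z : ℝ => DelayedRD.weight lam_c z * |φ₁ z - φ₂ z|) MeasureTheory.volume) :
    φ₁ = φ₂ := by
  have hc0 := hφ₁.speed_pos
  have hL := DelayedRD.one_lt_of_fixedPoints hκ hg_lip hg_fix
  have hE := DelayedRD.charFun_nonneg_of_mem_Icc hL hh hc0 hc hlam
  obtain ⟨d₁, dd₁, e₁⟩ := hφ₁.profile_equation
  obtain ⟨d₂, dd₂, e₂⟩ := hφ₂.profile_equation
  set ξ : ℝ → ℝ := DelayedRD.weight lam_c with hξ
  have hξpos : ∀ z, 0 < ξ z := fun z => Real.exp_pos _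
  have hξd : ∀ z, HasDerivAt ξ (-lam_c * ξ z) z := fun z => by
    have := ((hasDerivAt_id' z).const_mul lam_c).fun_neg.exp
    exact this.congr_deriv (by simp only [hξ, DelayedRD.weight]; ring)
  have hξshift : ∀ z, ξ z = Real.exp (-(lam_c * c * h)) * ξ (z - c * h) := fun z => by
    simp only [hξ, DelayedRD.weight, ← Real.exp_add]
    congr 1
    ring
  have hw : ∀ z, HasDerivAt (fun z => φ₁ z - φ₂ z) (deriv φ₁ z - deriv φ₂ z) z :=
    fun z => (d₁ z).hasDerivAt.sub (d₂ z).hasDerivAt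
  have hw' : ∀ z, HasDerivAt (fun z => deriv φ₁ z - deriv φ₂ z)
      (deriv (deriv φ₁) z - deriv (deriv φ₂) z) z :=
    fun z => (dd₁ z).hasDerivAt.sub (dd₂ z).hasDerivAt
  have hy := fun z => (hξd z).fun_mul (hw z)
  have hy' := fun z => (((hξd z).const_mul (-lam_c)).fun_mul (hw z)).fun_add
    ((hξd z).fun_mul (hw' z))
  have hint : Integrable (fun z => ξ z * (φ₁ z - φ₂ z)) := by
    have hcont : Continuous (fun z => ξ z * (φ₁ z - φ₂ z)) :=
      continuous_iff_continuousAt.2 fun z => (hy z).continuousAt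
    refine (integrable_norm_iff hcont.aestronglyMeasurable).1 (hic.congr (ae_of_all _ fun z => ?_))
    simp only [norm_mul, Real.norm_eq_abs, abs_of_pos (hξpos z)]
  have key := DelayedRD.eq_zero_of_integrable_delay
    (f := fun z => ξ z * (g (φ₁ (z - c * h)) - g (φ₂ (z - c * h))))
    (a := 2 * lam_c - c) (p := 1 + c * lam_c - lam_c ^ 2)
    (q := Lg * Real.exp (-(lam_c * c * h))) (τ := c * h) hy hy'
    (fun z => by linear_combination ξ z * (e₁ z) - ξ z * e₂ z) ?_ (by positivity)
    (mul_pos (by linarith) (Real.exp_pos _)) (by unfold DelayedRD.charFun at hE; linarith) hint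
  · funext z
    exact sub_eq_zero.1 ((mul_eq_zero.1 (key z)).resolve_left (hξpos z).ne')
  · intro z
    have hlip := hg_lip.dist_le_mul _ (hφ₁.pos (z - c * h)).le _ (hφ₂.pos (z - c * h)).le
    rw [Real.dist_eq, Real.dist_eq] at hlip
    rw [abs_mul, abs_mul, abs_of_pos (hξpos z), abs_of_pos (hξpos (z - c * h)), hξshift z]
    calc _ ≤ Real.exp (-(lam_c * c * h)) * ξ (z - c * h) *
          (Lg * |φ₁ (z - c * h) - φ₂ (z - c * h)|) :=
          mul_le_mul_of_nonneg_left hlip (mul_pos (Real.exp_pos _) (hξpos _)).le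
      _ = _ := by ring
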